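/- All graphs are finite, simple and undirected. A word $w$ over the alphabet $V$ \emph{represents} a graph $G=(V,E)$ if every $v\in V$ occurs in $w$ and, for all distinct $a,b\in V$, $\{a,b\}\in E$ if and only if $a$ and $b$ alternate in $w$, i.e. erasing all letters other than $a,b$ from $w$ leaves $(ab)^n$, $(ab)^na$, $(ba)^n$ or $(ba)^nb$ for some $n\ge 1$. For $k\ge 1$ let $\mathbb{R}^k$ be the class of graphs represented by some $k$-uniform word (each occurring letter occurs exactly $k$ times), and let $\mathcal{L}^k$ be the class of graphs represented by some $k$-local word. Here $w$ is \emph{$k$-local} if the distinct letters of $w$ can be enumerated as $a_1,\dots,a_n$ so that, for every $i\le n$, marking all occurrences of $a_1,\dots,a_i$ in $w$ produces at most $k$ maximal blocks of consecutive marked positions. Let $\mathscr{E}_{i,j}$ be the class of graphs whose nodes can be partitioned into $i$ independent sets and $j$ cliques (parts may be empty). The \emph{index} (colouring number) $c(X)$ of a class of graphs $X$ is the largest integer $m\ge 1$ such that $\mathscr{E}_{i,m-i}\subseteq X$ for some $0\le i\le m$. \textbf{Theorem.} For every integer $k\ge 1$, $c(\mathbb{R}^{k+1})=c(\mathcal{L}^k)=1$.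 -/

import Mathlib

universe u

namespace WordGraph

/-- A finite, undirected graph (without loops), on a finite node set of any kind. -/
structure FiniteGraph where
  Node : Type u
  finite_node : Finite Node
  graph : SimpleGraph Node

/-- A class of finite graphs. -/
abbrev GraphClass := Set FiniteGraph.{u}

section Words

variable {V : Type u}

open Classical in
/-- The projection of a word onto a set of letters: all other letters are erased. -/
noncomputable def proj (S : Set V) (w : List V) : List V :=
  w.filter (fun x => x ∈ S)

/-- The power `u ^ n` of a word. -/
def wordPow (v : List V) (n : ℕ) : List V := (List.replicate n v).flatten

/-- Two distinct letters `a`, `b` alternate in `w`: the projection of `w` onto `{a, b}` is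
`(ab)^n`, `(ab)^n a`, `(ba)^n` or `(ba)^n b` for some `n ≥ 1`. -/
def Alternate (w : List V) (a b : V) : Prop :=
  a ≠ b ∧ ∃ n : ℕ, 1 ≤ n ∧
    (proj {a, b} w = wordPow [a, b] n ∨ proj {a, b} w = wordPow [a, b] n ++ [a] ∨
      proj {a, b} w = wordPow [b, a] n ∨ proj {a, b} w = wordPow [b, a] n ++ [b])

/-- The word `w` represents `G`: its letters are exactly the nodes of `G`, and two nodes
alternate in `w` iff they are adjacent. -/
def Represents (w : List V) (G : SimpleGraph V) : Prop :=
  (∀ a : V, a ∈ w) ∧ ∀ a b : V, Alternate w a b ↔ G.Adj a b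

open Classical in
/-- Every letter that occurs in `w` occurs exactly `k` times. -/
def IsUniform (k : ℕ) (w : List V) : Prop :=
  ∀ a ∈ w, w.count a = k

/-- A marking sequence of `w`: an enumeration without repetition of the letters of `w`. -/
def IsMarkingSequence (s w : List V) : Prop :=
  s.Nodup ∧ ∀ a : V, a ∈ s ↔ a ∈ w

open Classical in
/-- The marked version of `w` at stage `i` with respect to `s`, as the list that tells position by
position whether the letter there is marked (`true`), i.e. is among the first `i` letters of `s`. -/
noncomputable def markedVersion (s w : List V) (i : ℕ) : List Bool :=
  w.map (fun x => decide (x ∈ s.take i))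

/-- The number of marked blocks, i.e. of maximal consecutive factors of entries `true`. -/
def blockCount : List Bool → ℕ
  | [] => 0
  | false :: l => blockCount l
  | [true] => 1
  | true :: false :: l => blockCount l + 1
  | true :: true :: l => blockCount (true :: l)

/-- `w` is `k`-local: for some marking sequence there are at most `k` marked blocks at every
stage. -/
def IsLocal (k : ℕ) (w : List V) : Prop :=
  ∃ s : List V, IsMarkingSequence s w ∧
    ∀ i : ℕ, i ≤ s.length → blockCount (markedVersion s w i) ≤ k

end Words

/-- The class `ℝ^k` of `k`-representable graphs: those represented by a `k`-uniform word. -/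
def representableClass (k : ℕ) : GraphClass.{u} :=
  {G | ∃ w : List G.Node, IsUniform k w ∧ Represents w G.graph}

/-- The class `ℒ^k` of graphs represented by a `k`-local word. -/
def localClass (k : ℕ) : GraphClass.{u} :=
  {G | ∃ w : List G.Node, IsLocal k w ∧ Represents w G.graph}

/-- The class `ℰ_{i,j}` of graphs whose nodes can be partitioned into `i` independent sets and `j`
cliques (parts may be empty); `f` sends a node to its part. -/
def partitionClass (i j : ℕ) : GraphClass.{u} :=
  {G | ∃ f : G.Node → Fin i ⊕ Fin j,
    (∀ p : Fin i, G.graph.IsIndepSet {v | f v = Sum.inl p}) ∧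
    ∀ q : Fin j, G.graph.IsClique {v | f v = Sum.inr q}}

/-- `m` is the index (colouring number) `c(X)` of `X`: the largest positive integer `m` such that
`ℰ_{i,m-i} ⊆ X` for some `0 ≤ i ≤ m`. -/
def HasIndex (X : GraphClass.{u}) (m : ℕ) : Prop :=
  IsGreatest {m : ℕ | 1 ≤ m ∧ ∃ i : ℕ, i ≤ m ∧ partitionClass i (m - i) ⊆ X} m

end WordGraph

namespace WordGraph

/-! ### Length bounds for uniform and local words. -/

section WordLemmas

variable {V : Type u}

/-! Complete graphs are represented by powers of an enumeration of the nodes, so the index is at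
least 1. The upper bound is by counting. Any two parts carry `2 ^ (n * n)` labelled graphs on `2 *
(n + 1)` nodes (`sidedGraph`). A word determines its graph, and words of linear length are too few
for large `n` (`exists_linear_pow_lt`).

Uniform words have linear length by definition. Local words may repeat a letter in place at will,
but not if the graph has no isolated node. Then any two neighbouring letters of the word are
separated at some marking stage, while each stage has at most `2 * k` changes between marked and
unmarked (`IsLocal.length_le`). -/

theorem wordPow_succ (v : List V) (n : ℕ) : wordPow v (n + 1) = v ++ wordPow v n := by
  simp [wordPow, List.replicate_succ]

/-- A word determines the graph that it represents. -/
theorem Represents.unique {w : List V} {G H : SimpleGraph V} (hG : Represents w G)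
    (hH : Represents w H) : G = H := by
  ext a b
  rw [← hG.2, ← hH.2]

theorem isChain_wordPow_pair {a b : V} (hab : a ≠ b) (n : ℕ) :
    List.IsChain (· ≠ ·) (wordPow [a, b] n) ∧
      List.IsChain (· ≠ ·) (wordPow [a, b] n ++ [a]) := by
  induction n with
  | zero => simp [wordPow]
  | succ n ih =>
    rw [wordPow_succ]
    cases n with
    | zero => simp [wordPow, hab, hab.symm]
    | succ m =>
      rw [wordPow_succ] at ih ⊢
      simpa [hab, hab.symm] using ih

theorem Alternate.isChain_proj {w : List V} {a b : V} (h : Alternate w a b) :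
    List.IsChain (· ≠ ·) (proj {a, b} w) := by
  obtain ⟨hab, n, -, h | h | h | h⟩ := h <;> rw [h]
  exacts [(isChain_wordPow_pair hab n).1, (isChain_wordPow_pair hab n).2,
    (isChain_wordPow_pair hab.symm n).1, (isChain_wordPow_pair hab.symm n).2]

/-- A word that represents a graph without isolated nodes has no factor `aa`. -/
theorem Represents.isChain_ne {w : List V} {G : SimpleGraph V} (h : Represents w G)
    (hG : ∀ a, ∃ b, G.Adj a b) : List.IsChain (· ≠ ·) w := by
  rw [List.isChain_iff_forall_rel_of_append_cons_cons]
  rintro a a' l₁ l₂ hw rfl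
  obtain ⟨b, hb⟩ := hG a
  have hc := ((h.2 a b).2 hb).isChain_proj
  rw [List.isChain_iff_forall_rel_of_append_cons_cons] at hc
  refine hc (l₁ := proj {a, b} l₁) (l₂ := proj {a, b} l₂) (a := a) (b := a) ?_ rfl
  simp [hw, proj]

/-- The number of positions of a list at which the entry differs from the next one. -/
def changeCount : List Bool → ℕ
  | [] => 0
  | [_] => 0
  | a :: b :: l => (if a = b then 0 else 1) + changeCount (b :: l)

/-- Each block has at most two ends, and a block at the very start has no change on its left. -/
theorem changeCount_cons_le (l : List Bool) :
    changeCount (true :: l) + 1 ≤ 2 * blockCount (true :: l) ∧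
      changeCount (false :: l) ≤ 2 * blockCount (false :: l) := by
  induction l with
  | nil => simp [changeCount, blockCount]
  | cons x l ih =>
    cases x <;> simp only [changeCount, blockCount] at ih ⊢ <;> simp <;> omega

theorem changeCount_le (l : List Bool) : changeCount l ≤ 2 * blockCount l := by
  rcases l with _ | ⟨_ | _, l⟩
  · simp [changeCount]
  · exact (changeCount_cons_le l).2
  · have := (changeCount_cons_le l).1
    omega

/-- Two distinct letters are separated by some initial segment of an enumeration. -/
theorem exists_mem_take_ne {s : List V} {a b : V} (hab : a ≠ b) (ha : a ∈ s) :
    ∃ i ≤ s.length, ¬ (a ∈ s.take i ↔ b ∈ s.take i) := by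
  induction s with
  | nil => simp at ha
  | cons x s ih =>
    by_cases hxa : a = x
    · exact ⟨1, by simp, by simp [hxa.symm, hab.symm]⟩
    by_cases hxb : b = x
    · exact ⟨1, by simp, by simp [hxb.symm, hab]⟩
    obtain ⟨i, hi, h⟩ := ih (by simpa [hxa] using ha)
    exact ⟨i + 1, by simpa using hi, by simpa [hxa, hxb] using h⟩

/-- Double counting: each of the `w.length - 1` neighbouring pairs is a change at some stage. -/
theorem length_le_sum_changeCount {s w : List V} (hs : ∀ a ∈ w, a ∈ s)
    (hw : List.IsChain (· ≠ ·) w) :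
    w.length ≤ ∑ i ∈ Finset.range (s.length + 1), changeCount (markedVersion s w i) + 1 := by
  induction w with
  | nil => simp
  | cons a l ih =>
    rcases l with _ | ⟨b, l⟩
    · simp
    rw [List.isChain_cons_cons] at hw
    have h := ih (fun c hc => hs c (List.mem_cons_of_mem _ hc)) hw.2
    obtain ⟨i, hi, hne⟩ := exists_mem_take_ne hw.1 (hs a (by simp))
    have hlt : ∑ i ∈ Finset.range (s.length + 1), changeCount (markedVersion s (b :: l) i) <
        ∑ i ∈ Finset.range (s.length + 1), changeCount (markedVersion s (a :: b :: l) i) := by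
      refine Finset.sum_lt_sum (fun j _ => ?_) ⟨i, Finset.mem_range.2 (by omega), ?_⟩
      · simp [markedVersion, changeCount]
      · simp [markedVersion, changeCount, hne]
    simp only [List.length_cons] at h ⊢
    omega

/-- A `k`-local word without factors `aa` has length linear in the number of letters. -/
theorem IsLocal.length_le [Fintype V] {k : ℕ} {w : List V} (h : IsLocal k w)
    (hw : List.IsChain (· ≠ ·) w) : w.length ≤ (2 * k + 1) * (Fintype.card V + 1) := by
  obtain ⟨s, ⟨hnd, hmem⟩, hs⟩ := h
  have h1 := length_le_sum_changeCount (fun a ha => (hmem a).2 ha) hw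
  have h2 : ∑ i ∈ Finset.range (s.length + 1), changeCount (markedVersion s w i) ≤
      (s.length + 1) * (2 * k) := by
    refine (Finset.sum_le_card_nsmul _ _ (2 * k) fun i hi => ?_).trans (by simp)
    refine (changeCount_le _).trans (Nat.mul_le_mul_left 2 (hs i ?_))
    rw [Finset.mem_range] at hi
    omega
  have h3 := hnd.length_le_card
  nlinarith [Nat.mul_le_mul_right (2 * k) h3]

theorem IsUniform.length_le [Fintype V] {k : ℕ} {w : List V} (h : IsUniform k w) :
    w.length ≤ k * (Fintype.card V + 1) := by
  classical
  have h1 : w.length = ∑ a : V, w.count a := by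
    have := Multiset.sum_count_eq_card (s := Finset.univ) (m := (w : Multiset V)) (by simp)
    simpa using this.symm
  have h2 : ∑ a : V, w.count a ≤ Fintype.card V * k := by
    refine (Finset.sum_le_card_nsmul _ _ k fun a _ => ?_).trans (by simp)
    by_cases ha : a ∈ w
    · have := h a ha
      convert this.le
    · simp [List.count_eq_zero_of_not_mem ha]
  nlinarith

/-- A family of lists of length at most `L` has at most `(|V| + 1) ^ L` members. -/
theorem card_le_of_injective_list [Fintype V] {ι : Type*} [Fintype ι] (L : ℕ) (W : ι → List V)
    (hW : Function.Injective W) (hL : ∀ x, (W x).length ≤ L) :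
    Fintype.card ι ≤ (Fintype.card V + 1) ^ L := by
  -- Shorter lists are padded with `none`, whence the base `|V| + 1`.
  have hinj : Function.Injective (fun (x : ι) (i : Fin L) => (W x)[(i : ℕ)]?) := by
    intro x y hxy
    apply hW
    refine List.ext_getElem? fun i => ?_
    by_cases hi : i < L
    · exact congrFun hxy ⟨i, hi⟩
    · rw [List.getElem?_eq_none ((hL x).trans (not_lt.1 hi)),
        List.getElem?_eq_none ((hL y).trans (not_lt.1 hi))]
  simpa using Fintype.card_le_of_injective _ hinj

end WordLemmas

/-! ### Many graphs with two prescribed parts. -/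

section Counting

/-- The graph on two sides `{0, …, n}`, each of which is a clique or an independent set as told by
`p`, in which the nodes `0` are joined to the whole other side and the other cross edges are given
by `M`. -/
def sidedGraph {n : ℕ} (p : Bool → Prop) (M : Fin n → Fin n → Prop) :
    SimpleGraph (ULift.{u} (Bool × Fin (n + 1))) :=
  SimpleGraph.fromRel fun x y =>
    (x.down.1 = y.down.1 ∧ p x.down.1) ∨
      (x.down.1 = false ∧ y.down.1 = true ∧ ∀ i j : Fin n, x.down.2 = i.succ → y.down.2 = j.succ →
        M i j)

theorem sidedGraph_adj_same {n : ℕ} (p : Bool → Prop) (M : Fin n → Fin n → Prop)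
    {x y : ULift.{u} (Bool × Fin (n + 1))} (h : x.down.1 = y.down.1) :
    (sidedGraph p M).Adj x y ↔ x ≠ y ∧ p x.down.1 := by
  simp only [sidedGraph, SimpleGraph.fromRel_adj, h]
  cases y.down.1 <;> simp

theorem sidedGraph_adj_succ {n : ℕ} (p : Bool → Prop) (M : Fin n → Fin n → Prop) (i j : Fin n) :
    (sidedGraph.{u} p M).Adj ⟨false, i.succ⟩ ⟨true, j.succ⟩ ↔ M i j := by
  simp [sidedGraph]

/-- The purpose of the extra nodes `0`: they exclude isolated nodes whatever `M` is. -/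
theorem sidedGraph_exists_adj {n : ℕ} (p : Bool → Prop) (M : Fin n → Fin n → Prop)
    (x : ULift.{u} (Bool × Fin (n + 1))) : ∃ y, (sidedGraph p M).Adj x y := by
  obtain ⟨b, i⟩ := x
  refine ⟨⟨!b, 0⟩, ?_⟩
  cases b <;> simp [sidedGraph, (Fin.succ_ne_zero _).symm]

theorem sidedGraph_injective {n : ℕ} (p : Bool → Prop) :
    Function.Injective (sidedGraph.{u} (n := n) p) := by
  intro M M' h
  funext i j
  rw [eq_iff_iff, ← sidedGraph_adj_succ.{u} p M, ← sidedGraph_adj_succ.{u} p M', h]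

theorem sidedGraph_mem_partitionClass {n i j : ℕ} {x y : Fin i ⊕ Fin j} (hxy : x ≠ y)
    (M : Fin n → Fin n → Prop) :
    (⟨ULift.{u} (Bool × Fin (n + 1)), inferInstance,
      sidedGraph (fun b => (cond b x y).isRight) M⟩ : FiniteGraph.{u}) ∈ partitionClass i j := by
  have hinj : ∀ b b' : Bool, cond b x y = cond b' x y → b = b' := by
    intro b b'
    cases b <;> cases b' <;> simp [hxy, hxy.symm]
  refine ⟨fun v => cond v.down.1 x y, fun p v hv w hw _ hvw => ?_, fun q v hv w hw hne => ?_⟩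
  · simp only [Set.mem_ofPred_eq] at hv hw
    rw [sidedGraph_adj_same _ _ (hinj _ _ (hv.trans hw.symm)), hv] at hvw
    simp at hvw
  · simp only [Set.mem_ofPred_eq] at hv hw
    rw [sidedGraph_adj_same _ _ (hinj _ _ (hv.trans hw.symm)), hv]
    simpa using hne

theorem mul_add_lt_two_pow (c : ℕ) : c * c + 13 * c < 128 * 2 ^ c := by
  induction c with
  | zero => simp
  | succ c ih =>
    have := @Nat.lt_two_pow_self c
    rw [pow_succ]
    nlinarith

theorem exists_linear_pow_lt (c : ℕ) :
    ∃ n : ℕ, (2 * (n + 1) + 1) ^ (c * (2 * (n + 1) + 1)) < 2 ^ (n * n) := by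
  -- This makes `8 * n` a power of two, so only exponents need comparing; `1024 = 8 * 128` matches
  -- `mul_add_lt_two_pow`.
  refine ⟨2 ^ (c + 10), ?_⟩
  set n := 2 ^ (c + 10) with hn
  have hn1 : 1 ≤ n := Nat.one_le_two_pow
  have h8 : 2 * (n + 1) + 1 ≤ 8 * n := by omega
  have hpow : 8 * n = 2 ^ (c + 13) := by rw [hn]; ring
  have hlt : 8 * (c * c + 13 * c) < n := by
    have := mul_add_lt_two_pow c
    rw [hn, pow_add]
    omega
  calc (2 * (n + 1) + 1) ^ (c * (2 * (n + 1) + 1))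
      ≤ (8 * n) ^ (c * (2 * (n + 1) + 1)) := Nat.pow_le_pow_left h8 _
    _ ≤ (8 * n) ^ (c * (8 * n)) :=
        Nat.pow_le_pow_right (by omega) (Nat.mul_le_mul_left c h8)
    _ = 2 ^ (8 * (c * c + 13 * c) * n) := by
        conv_lhs => rw [show (8 * n) ^ (c * (8 * n)) = (2 ^ (c + 13)) ^ (c * (8 * n)) by rw [hpow]]
        rw [← pow_mul]
        congr 1
        ring
    _ < 2 ^ (n * n) := Nat.pow_lt_pow_right (by norm_num) (Nat.mul_lt_mul_of_pos_right hlt hn1)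

/-- If the graphs of `X` without isolated nodes are represented by words of linear length, then `X`
contains no class `ℰ_{i,j}` with `i + j ≥ 2`. -/
theorem not_partitionClass_subset (X : GraphClass.{u}) (c : ℕ)
    (hX : ∀ G ∈ X, ∀ _ : Fintype G.Node, (∀ a, ∃ b, G.graph.Adj a b) →
      ∃ w : List G.Node, Represents w G.graph ∧ w.length ≤ c * (Fintype.card G.Node + 1))
    {i j : ℕ} (hij : 2 ≤ i + j) : ¬ partitionClass i j ⊆ X := by
  classical
  intro hsub
  obtain ⟨x, y, hxy⟩ : ∃ x y : Fin i ⊕ Fin j, x ≠ y := by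
    have : 1 < Fintype.card (Fin i ⊕ Fin j) := by simp; omega
    exact Fintype.exists_pair_of_one_lt_card this
  obtain ⟨n, hn⟩ := exists_linear_pow_lt c
  have hw : ∀ M : Fin n → Fin n → Prop, ∃ w : List (ULift.{u} (Bool × Fin (n + 1))),
      Represents w (sidedGraph (fun b => (cond b x y).isRight) M) ∧
        w.length ≤ c * (Fintype.card (ULift.{u} (Bool × Fin (n + 1))) + 1) := fun M =>
    hX _ (hsub (sidedGraph_mem_partitionClass.{u} hxy M)) 
      (inferInstanceAs (Fintype (ULift.{u} (Bool × Fin (n + 1)))))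
      (sidedGraph_exists_adj.{u} (fun b => (cond b x y).isRight) M)
  choose W hW hlen using hw
  have hinj : Function.Injective W := by
    intro M M' h
    have hM := hW M
    rw [h] at hM
    exact sidedGraph_injective.{u} (fun b => (cond b x y).isRight) (hM.unique (hW M'))
  have hcard := card_le_of_injective_list _ W hinj hlen
  refine absurd hcard (not_le.2 ?_)
  simpa [pow_mul] using hn

end Counting

/-! ### Words for complete graphs. -/

section Cliques

variable {V : Type u}

theorem proj_pair_of_nodup {s : List V} (hs : s.Nodup) {a b : V} (hab : a ≠ b) (ha : a ∈ s)
    (hb : b ∈ s) : proj {a, b} s = [a, b] ∨ proj {a, b} s = [b, a] := by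
  classical
  have hp : List.Perm (proj {a, b} s) [a, b] := by
    unfold proj
    rw [List.perm_ext_iff_of_nodup (hs.filter _) (by simpa using hab)]
    intro c
    simp only [List.mem_filter, decide_eq_true_eq, Set.mem_insert_iff, Set.mem_singleton_iff,
      List.mem_cons, List.not_mem_nil, or_false]
    constructor
    · exact fun h => h.2
    · rintro (rfl | rfl) <;> simp [*]
  have hlen := hp.length_eq
  have hnd := hp.nodup_iff.2 (by simpa using hab)
  have hmem := fun c => hp.mem_iff (a := c)
  obtain ⟨c, d, hcd⟩ := List.length_eq_two.1 hlen
  rw [hcd] at hnd hmem ⊢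
  have h1 := (hmem c).1 (by simp)
  have h2 := (hmem d).1 (by simp)
  simp only [List.nodup_cons, List.mem_cons, List.not_mem_nil, or_false] at hnd h1 h2
  rcases h1 with rfl | rfl <;> rcases h2 with rfl | rfl <;> simp_all

theorem proj_wordPow (S : Set V) (v : List V) (n : ℕ) :
    proj S (wordPow v n) = wordPow (proj S v) n := by
  simp [proj, wordPow, List.filter_flatten]

/-- Powers of an enumeration of the nodes represent the complete graph. -/
theorem represents_wordPow_of_complete {G : SimpleGraph V} (hG : ∀ a b, a ≠ b → G.Adj a b)
    {s : List V} (hs : s.Nodup) (hmem : ∀ a, a ∈ s) (n : ℕ) :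
    Represents (wordPow s (n + 1)) G := by
  refine ⟨fun a => ?_, fun a b => ⟨fun h => hG a b h.1, fun h => ⟨h.ne, n + 1, by omega, ?_⟩⟩⟩
  · rw [wordPow_succ]
    exact List.mem_append_left _ (hmem a)
  · rw [proj_wordPow]
    rcases proj_pair_of_nodup hs h.ne (hmem a) (hmem b) with h | h <;> simp [h]

theorem isUniform_wordPow {s : List V} (hs : s.Nodup) (hmem : ∀ a, a ∈ s) (n : ℕ) :
    IsUniform n (wordPow s n) := by
  classical
  intro a _
  simp [wordPow, List.count_flatten, List.count_eq_one_of_mem hs (hmem a)]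

theorem blockCount_replicate_false (n : ℕ) : blockCount (List.replicate n false) = 0 := by
  induction n with
  | zero => rfl
  | succ n ih => simpa [List.replicate_succ, blockCount] using ih

theorem blockCount_prefix_le_one (m n : ℕ) :
    blockCount (List.replicate m true ++ List.replicate n false) ≤ 1 := by
  induction m with
  | zero => simp [blockCount_replicate_false]
  | succ m ih =>
    rcases m with _ | m
    · rcases n with _ | n
      · simp [blockCount]
      · simp [List.replicate_succ, blockCount, blockCount_replicate_false]
    · simpa [List.replicate_succ, blockCount] using ih

/-- With `s` as its own marking sequence, the marked positions always form a prefix. -/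
theorem isLocal_of_nodup {k : ℕ} (hk : 1 ≤ k) {s : List V} (hs : s.Nodup) : IsLocal k s := by
  classical
  refine ⟨s, ⟨hs, fun _ => Iff.rfl⟩, fun i _ => le_trans ?_ hk⟩
  have h : markedVersion s s i =
      List.replicate (s.take i).length true ++ List.replicate (s.drop i).length false := by
    unfold markedVersion
    have hd := hs
    rw [← List.take_append_drop i s, List.nodup_append] at hd
    conv_lhs => rw [← List.take_append_drop i s, List.map_append]
    congr 1
    · rw [List.eq_replicate_iff]
      refine ⟨by simp, ?_⟩
      simp only [List.mem_map, List.take_append_drop]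
      rintro _ ⟨c, hc, rfl⟩
      simpa using hc
    · rw [List.eq_replicate_iff]
      refine ⟨by simp, ?_⟩
      simp only [List.mem_map, List.take_append_drop]
      rintro _ ⟨c, hc, rfl⟩
      simpa using fun h => hd.2.2 c h c hc rfl
  rw [h]
  exact blockCount_prefix_le_one _ _

theorem exists_enumeration [Finite V] : ∃ s : List V, s.Nodup ∧ ∀ a, a ∈ s := by
  have := Fintype.ofFinite V
  exact ⟨Finset.univ.toList, Finset.nodup_toList _, by simp⟩

theorem adj_of_mem_partitionClass {G : FiniteGraph.{u}} (h : G ∈ partitionClass 0 1) :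
    ∀ a b, a ≠ b → G.graph.Adj a b := by
  obtain ⟨f, -, hf⟩ := h
  have hz : ∀ a, f a = Sum.inr 0 := fun a => by
    rcases f a with p | q
    · exact p.elim0
    · rw [Subsingleton.elim q 0]
  exact fun a b hab => hf 0 (hz a) (hz b) hab

end Cliques

theorem hasIndex_one_of_linear (X : GraphClass.{u}) (c : ℕ)
    (hX : ∀ G ∈ X, ∀ _ : Fintype G.Node, (∀ a, ∃ b, G.graph.Adj a b) →
      ∃ w : List G.Node, Represents w G.graph ∧ w.length ≤ c * (Fintype.card G.Node + 1))
    (hcl : partitionClass 0 1 ⊆ X) : HasIndex X 1 := by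
  refine ⟨⟨le_rfl, 0, by omega, hcl⟩, ?_⟩
  rintro m ⟨-, i, hi, hsub⟩
  by_contra hm
  exact not_partitionClass_subset X c hX (by omega) hsub

theorem hasIndex_representableClass (k : ℕ) : HasIndex (representableClass.{u} (k + 1)) 1 := by
  refine hasIndex_one_of_linear _ (k + 1) ?_ ?_
  · rintro G ⟨w, hu, hr⟩ _ -
    exact ⟨w, hr, hu.length_le⟩
  · intro G hG
    have := G.finite_node
    obtain ⟨s, hs, hmem⟩ := exists_enumeration (V := G.Node)
    exact ⟨wordPow s (k + 1), isUniform_wordPow hs hmem _,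
      represents_wordPow_of_complete (adj_of_mem_partitionClass hG) hs hmem k⟩

theorem hasIndex_localClass {k : ℕ} (hk : 1 ≤ k) : HasIndex (localClass.{u} k) 1 := by
  refine hasIndex_one_of_linear _ (2 * k + 1) ?_ ?_
  · rintro G ⟨w, hl, hr⟩ _ hG
    exact ⟨w, hr, hl.length_le (hr.isChain_ne hG)⟩
  · intro G hG
    have := G.finite_node
    obtain ⟨s, hs, hmem⟩ := exists_enumeration (V := G.Node)
    have hr := represents_wordPow_of_complete (adj_of_mem_partitionClass hG) hs hmem 0
    simp only [wordPow, zero_add, List.replicate_one, List.flatten_singleton] at hr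
    exact ⟨s, isLocal_of_nodup hk hs, hr⟩

end WordGraph

theorem mainTheorem6 (k : ℕ) (hk : 1 ≤ k) :
    WordGraph.HasIndex (WordGraph.representableClass.{u} (k + 1)) 1 ∧
      WordGraph.HasIndex (WordGraph.localClass.{u} k) 1 :=
  ⟨WordGraph.hasIndex_representableClass k, WordGraph.hasIndex_localClass hk⟩
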